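/- Let $p\in(1,\infty)$ and $q=p/(p-1)$. Let $E$ be a separable real Banach space with continuous dual $E^*$, and let $(X_i)_{i\ge 1}$ be i.i.d. $E$-valued (Borel measurable) random variables with $\mathbb E\|X_1\|^q<\infty$. For $x^*\in E^*$ define \[ \Lambda(x^*)=\inf\left\{m\in\mathbb R:\ \mathbb E\left[\left((1+\langle x^*,X_1\rangle-m)^+\right)^q\right]\le 1\right\}, \] and for $x\in E$ define $\Lambda^*(x)=\sup_{x^*\in E^*}\left(\langle x^*,x\rangle-\Lambda(x^*)\right)\in[0,\infty]$. Then, for every closed set $A\subset E$, \[ \limsup_{n\to\infty}\ n^{1/p}\,\mathbb P\left(\frac1n\sum_{i=1}^n X_i\in A\right)^{1/q}\ \le\ \left(\inf_{x\in A}\Lambda^*(x)\right)^{-1}, \] where $\inf\emptyset=\infty$, $0^{-1}=\infty$ and $\infty^{-1}=0$. -/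

import Mathlib

open MeasureTheory ProbabilityTheory Filter
open scoped ENNReal

noncomputable section

/-- `Λ(x*) = inf {m ∈ ℝ : E[((1 + ⟨x*, Y⟩ - m)⁺)^q] ≤ 1}`, as an extended real number
(the infimum of the empty set is `⊤`). The expectation of the nonnegative random variable is
its Lebesgue integral with values in `[0, ∞]`. -/
def shortfallCumulant {Ω E : Type*} [MeasurableSpace Ω] [NormedAddCommGroup E] [NormedSpace ℝ E]
    (P : Measure Ω) (q : ℝ) (Y : Ω → E) (x' : StrongDual ℝ E) : EReal :=
  sInf ((fun m : ℝ => (m : EReal)) ''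
    {m : ℝ | ∫⁻ ω, ENNReal.ofReal ((max (1 + x' (Y ω) - m) 0) ^ q) ∂P ≤ 1})

/-- The convex conjugate `Λ*(x) = sup_{x*} (⟨x*, x⟩ - Λ(x*))` of a function `Λ` on the continuous
dual of `E`, as a function on `E`. -/
def convexConjugate {E : Type*} [NormedAddCommGroup E] [NormedSpace ℝ E]
    (L : StrongDual ℝ E → EReal) (x : E) : EReal :=
  ⨆ x' : StrongDual ℝ E, (((x' x : ℝ) : EReal) - L x')

/-- `Λ*` is nonnegative, so that `Λ*` and its infima may be read in `[0, ∞]` without loss. -/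
theorem convexConjugate_shortfallCumulant_nonneg {Ω E : Type*} [MeasurableSpace Ω]
    [NormedAddCommGroup E] [NormedSpace ℝ E] (P : Measure Ω) [IsProbabilityMeasure P]
    (q : ℝ) (Y : Ω → E) (x : E) :
    0 ≤ convexConjugate (shortfallCumulant P q Y) x := by
  have h : shortfallCumulant P q Y 0 ≤ 0 := by
    refine sInf_le ⟨0, ?_, by simp⟩
    simp
  refine le_trans ?_ (le_iSup (fun x' : StrongDual ℝ E =>
    (((x' x : ℝ) : EReal) - shortfallCumulant P q Y x')) 0)
  simpa [sub_eq_add_neg] using h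

end

open scoped Topology

/-! The proof splits on whether the mean `E X` lies in `A`. If it does, Bernoulli's inequality gives
`⟨x*, E X⟩ ≤ Λ(x*)` for all `x*`, so `Λ*(E X) ≤ 0` and the right side is `∞`. If not, `A` misses a
ball of radius `δ` around `E X`, and the left side tends to `0`, since `P(‖S_n / n - E X‖ ≥ δ) = o(n
^ (1 - q))` and `(q - 1) / q = 1 / p`. No duality or minimax argument is needed.

The rate (`hasTailRate_mean`) rests on an upper-tail bound for sums of nonnegative real variables:
truncate at height `n * s`, control the truncated sum by Chernoff with parameter of order `log n /
n`, and control the large values by a union bound. It passes to `E` by approximating `X` in `L¹` by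
a simple function of `X`: the simple part reduces to empirical frequencies, and the norm of the
error is again a nonnegative real variable, of small mean. -/

theorem exp_le_one_add_add_rpow_mul_exp {x M a : ℝ} (hx : 0 ≤ x) (hxM : x ≤ M) (hM : 0 < M)
    (ha2 : a ≤ 2) : Real.exp x ≤ 1 + x + 2 * ((x / M) ^ a * Real.exp (2 * M)) := by
  rcases hx.eq_or_lt with rfl | hx0
  · have : 0 ≤ 2 * (((0 : ℝ) / M) ^ a * Real.exp (2 * M)) := by positivity
    simpa using this
  have h1 : Real.exp x - 1 ≤ x * Real.exp x := by
    have h := mul_le_mul_of_nonneg_right (Real.add_one_le_exp (-x)) (Real.exp_pos x).le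
    rw [← Real.exp_add] at h
    simp only [neg_add_cancel, Real.exp_zero] at h
    linarith
  have h2 : Real.exp x - 1 - x ≤ x ^ 2 * Real.exp x := by nlinarith
  have h3 : x ^ 2 = (x / M) ^ (2 : ℝ) * M ^ 2 := by
    rw [Real.rpow_two]; field_simp
  -- As `x / M ≤ 1`, the quadratic remainder is bounded by a power `a ≤ 2`, so a moment of order `a`
  -- suffices later.
  have h4 : (x / M) ^ (2 : ℝ) ≤ (x / M) ^ a :=
    Real.rpow_le_rpow_of_exponent_ge (by positivity) (by rw [div_le_one hM]; exact hxM) ha2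
  have h5 : M ^ 2 ≤ 2 * Real.exp M := by
    have := Real.quadratic_le_exp_of_nonneg hM.le
    linarith
  have h6 : Real.exp x ≤ Real.exp M := Real.exp_le_exp.mpr hxM
  have h7 : x ^ 2 * Real.exp x ≤ (x / M) ^ a * (2 * Real.exp M) * Real.exp M := by
    rw [h3]; gcongr
  have h8 : Real.exp (2 * M) = Real.exp M * Real.exp M := by rw [← Real.exp_add]; ring_nf
  rw [h8]
  linarith

/-! ### Upper tails of sums of nonnegative real variables -/

section UpperTail

variable {Ω : Type*} [MeasurableSpace Ω] {P : Measure Ω} [IsProbabilityMeasure P]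

theorem mgf_min_const_le {U : Ω → ℝ} (h0 : ∀ ω, 0 ≤ U ω) {a l M : ℝ}
    (ha : 0 < a) (ha2 : a ≤ 2) (hl : 0 < l) (hM : 0 < M) (hint : Integrable U P)
    (hinta : Integrable (fun ω => U ω ^ a) P) :
    mgf (fun ω => min (U ω) M) P l ≤
      1 + l * ∫ ω, U ω ∂P + 2 * ((∫ ω, U ω ^ a ∂P) / M ^ a * Real.exp (2 * (l * M))) := by
  have key : ∀ ω, Real.exp (l * min (U ω) M) ≤
      1 + l * U ω + 2 * (U ω ^ a / M ^ a * Real.exp (2 * (l * M))) := by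
    intro ω
    have hv0 : 0 ≤ min (U ω) M := le_min (h0 ω) hM.le
    have h := exp_le_one_add_add_rpow_mul_exp (x := l * min (U ω) M) (M := l * M) (a := a)
      (by positivity) (by gcongr; exact min_le_right _ _) (by positivity) ha2
    refine h.trans ?_
    rw [mul_div_mul_left _ _ hl.ne', Real.div_rpow hv0 hM.le]
    gcongr <;> exact min_le_left _ _
  have hI : Integrable (fun ω => 1 + l * U ω + 2 * (U ω ^ a / M ^ a * Real.exp (2 * (l * M)))) P :=
    ((integrable_const _).add (hint.const_mul l)).add
      (((hinta.div_const _).mul_const _).const_mul 2)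
  calc mgf (fun ω => min (U ω) M) P l
      ≤ ∫ ω, (1 + l * U ω + 2 * (U ω ^ a / M ^ a * Real.exp (2 * (l * M)))) ∂P := by
        refine integral_mono_of_nonneg (ae_of_all _ fun ω => (Real.exp_pos _).le) hI
          (ae_of_all _ key)
    _ = _ := by
        rw [integral_add (f := fun ω => 1 + l * U ω) ((integrable_const _).add (hint.const_mul l))
          (((hinta.div_const _).mul_const _).const_mul 2),
          integral_add (integrable_const _) (hint.const_mul l), integral_const_mul,
          integral_const_mul, integral_mul_const, integral_div]
        simp

omit [IsProbabilityMeasure P] in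
-- Markov's inequality restricted to the event itself: the restricted integral of `(U / s) ^ q`
-- vanishes by dominated convergence, which improves `O` to `o`.
theorem tendsto_rpow_mul_measureReal_ge {U : Ω → ℝ} (hU : Measurable U) (h0 : ∀ ω, 0 ≤ U ω)
    {q s : ℝ} (hq : 0 < q) (hs : 0 < s) (hint : Integrable (fun ω => U ω ^ q) P) :
    Tendsto (fun n : ℕ => (n : ℝ) ^ q * P.real {ω | n * s ≤ U ω}) atTop (𝓝 0) := by
  have hlim : Tendsto (fun n : ℕ => ∫ ω, (if n * s ≤ U ω then (U ω / s) ^ q else 0) ∂P) atTop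
      (𝓝 (∫ _, (0 : ℝ) ∂P)) := by
    refine tendsto_integral_of_dominated_convergence (fun ω => (U ω / s) ^ q) ?_ ?_ ?_ ?_
    · intro n
      refine (Measurable.ite (measurableSet_le measurable_const hU) ?_ measurable_const)
        |>.aestronglyMeasurable
      fun_prop
    · simp_rw [fun ω => Real.div_rpow (h0 ω) hs.le q]
      exact hint.div_const _
    · intro n
      refine ae_of_all _ fun ω => ?_
      have : 0 ≤ (U ω / s) ^ q := Real.rpow_nonneg (div_nonneg (h0 ω) hs.le) _
      split_ifs
      · rw [Real.norm_of_nonneg this]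
      · simpa using this
    · refine ae_of_all _ fun ω => ?_
      refine tendsto_const_nhds.congr' ?_
      obtain ⟨N, hN⟩ := exists_nat_gt (U ω / s)
      filter_upwards [eventually_ge_atTop N] with n hn
      have : U ω < n * s := by
        rw [div_lt_iff₀ hs] at hN
        refine hN.trans_le ?_
        gcongr
      rw [if_neg (not_le.mpr this)]
  rw [integral_zero] at hlim
  refine tendsto_of_tendsto_of_tendsto_of_le_of_le tendsto_const_nhds hlim
    (fun n => by positivity) fun n => ?_
  have hm : MeasurableSet {ω | n * s ≤ U ω} := measurableSet_le measurable_const hU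
  calc (n : ℝ) ^ q * P.real {ω | n * s ≤ U ω}
      = ∫ ω, {ω | n * s ≤ U ω}.indicator (fun _ => (n : ℝ) ^ q) ω ∂P := by
        rw [integral_indicator_const _ hm, smul_eq_mul, mul_comm]
    _ ≤ _ := by
        refine integral_mono_of_nonneg (ae_of_all _ fun ω => ?_) ?_ (ae_of_all _ fun ω => ?_)
        · exact Set.indicator_nonneg (fun _ _ => by positivity) _
        · refine Integrable.mono' (g := fun ω => U ω ^ q / s ^ q) (hint.div_const _) ?_
            (ae_of_all _ fun ω => ?_)
          · refine (Measurable.ite hm ?_ measurable_const).aestronglyMeasurable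
            fun_prop
          · rw [← Real.div_rpow (h0 ω) hs.le]
            have : 0 ≤ (U ω / s) ^ q := Real.rpow_nonneg (div_nonneg (h0 ω) hs.le) _
            split_ifs
            · rw [Real.norm_of_nonneg this]
            · simpa using this
        · by_cases h : n * s ≤ U ω
          · simp only [Set.indicator, Set.mem_ofPred_eq, h, if_true]
            gcongr
            rwa [le_div_iff₀ hs]
          · simp [Set.indicator, h]

/-- A Fuk–Nagaev type bound: either some summand reaches `M`, or the sum equals the sum truncated at
`M`, to which Chernoff applies. -/
theorem measureReal_sum_ge_le {U : ℕ → Ω → ℝ} (hU : ∀ i, Measurable (U i))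
    (h0 : ∀ i ω, 0 ≤ U i ω) (hindep : iIndepFun U P)
    (hident : ∀ i, IdentDistrib (U i) (U 0) P P) {a l M : ℝ}
    (ha : 0 < a) (ha2 : a ≤ 2) (hl : 0 < l) (hM : 0 < M) (hint : Integrable (U 0) P)
    (hinta : Integrable (fun ω => U 0 ω ^ a) P) (n : ℕ) (t : ℝ) :
    P.real {ω | n * t ≤ ∑ i ∈ Finset.range n, U i ω} ≤
      n * P.real {ω | M ≤ U 0 ω} +
      Real.exp (-l * (n * t) + n * (l * ∫ ω, U 0 ω ∂P +
        2 * ((∫ ω, U 0 ω ^ a ∂P) / M ^ a * Real.exp (2 * (l * M))))) := by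
  set V : ℕ → Ω → ℝ := fun i ω => min (U i ω) M with hV
  have hVm : ∀ i, Measurable (V i) := fun i => (hU i).min measurable_const
  have hVind : iIndepFun V P :=
    hindep.comp (fun _ x => min x M) fun _ => measurable_id.min measurable_const
  have hsub : {ω | n * t ≤ ∑ i ∈ Finset.range n, U i ω} ⊆
      (⋃ i ∈ Finset.range n, {ω | M ≤ U i ω}) ∪
        {ω | n * t ≤ (∑ i ∈ Finset.range n, V i) ω} := by
    intro ω hω
    by_cases h : ∃ i ∈ Finset.range n, M ≤ U i ω
    · left
      simpa using h
    · right
      push Not at h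
      simp only [Set.mem_ofPred_eq, Finset.sum_apply] at hω ⊢
      refine hω.trans_eq (Finset.sum_congr rfl fun i hi => ?_)
      exact (min_eq_left (h i hi).le).symm
  have hunion : P.real (⋃ i ∈ Finset.range n, {ω | M ≤ U i ω}) ≤ n * P.real {ω | M ≤ U 0 ω} := by
    refine (measureReal_biUnion_finset_le _ _).trans_eq ?_
    have : ∀ i ∈ Finset.range n, P.real {ω | M ≤ U i ω} = P.real {ω | M ≤ U 0 ω} := by
      intro i _
      have := (hident i).measure_mem_eq (s := Set.Ici M) measurableSet_Ici
      exact congrArg ENNReal.toReal this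
    rw [Finset.sum_congr rfl this]
    simp
  have hbdd : Integrable (fun ω => Real.exp (l * (∑ i ∈ Finset.range n, V i) ω)) P := by
    refine Integrable.of_bound (C := Real.exp (l * (n * M))) ?_ (ae_of_all _ fun ω => ?_)
    · refine Measurable.aestronglyMeasurable ?_
      simp only [Finset.sum_apply]
      fun_prop
    · rw [Real.norm_of_nonneg (Real.exp_pos _).le, Real.exp_le_exp]
      gcongr
      rw [Finset.sum_apply]
      calc ∑ i ∈ Finset.range n, V i ω ≤ ∑ _i ∈ Finset.range n, M :=
            Finset.sum_le_sum fun i _ => min_le_right _ _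
        _ = n * M := by simp
  have hmgf : mgf (∑ i ∈ Finset.range n, V i) P l ≤
      Real.exp (n * (l * ∫ ω, U 0 ω ∂P +
        2 * ((∫ ω, U 0 ω ^ a ∂P) / M ^ a * Real.exp (2 * (l * M))))) := by
    rw [hVind.mgf_sum hVm]
    have h1 : ∀ i ∈ Finset.range n, mgf (V i) P l ≤ Real.exp (l * ∫ ω, U 0 ω ∂P +
        2 * ((∫ ω, U 0 ω ^ a ∂P) / M ^ a * Real.exp (2 * (l * M)))) := by
      intro i _
      have hid : IdentDistrib (V i) (V 0) P P :=
        (hident i).comp (measurable_id.min measurable_const)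
      rw [mgf_congr_of_identDistrib _ _ hid]
      refine (mgf_min_const_le (h0 0) ha ha2 hl hM hint hinta).trans ?_
      refine le_trans (le_of_eq ?_) (Real.add_one_le_exp _)
      ring
    refine (Finset.prod_le_prod (fun i _ => mgf_nonneg) h1).trans_eq ?_
    rw [Finset.prod_const, Finset.card_range, ← Real.exp_nat_mul]
  calc _ ≤ P.real ((⋃ i ∈ Finset.range n, {ω | M ≤ U i ω}) ∪
        {ω | n * t ≤ (∑ i ∈ Finset.range n, V i) ω}) := measureReal_mono hsub
    _ ≤ _ := measureReal_union_le _ _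
    _ ≤ _ := by
      refine add_le_add hunion ?_
      refine (measure_ge_le_exp_mul_mgf _ hl.le hbdd).trans ?_
      rw [Real.exp_add]
      gcongr

theorem tendsto_rpow_mul_measureReal_sum_ge {U : ℕ → Ω → ℝ} (hU : ∀ i, Measurable (U i))
    (h0 : ∀ i ω, 0 ≤ U i ω) (hindep : iIndepFun U P)
    (hident : ∀ i, IdentDistrib (U i) (U 0) P P) {q : ℝ} (hq : 1 < q)
    (hint : Integrable (fun ω => U 0 ω ^ q) P) {t : ℝ} (ht : ∫ ω, U 0 ω ∂P < t) :
    Tendsto (fun n : ℕ => (n : ℝ) ^ (q - 1) *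
      P.real {ω | n * t ≤ ∑ i ∈ Finset.range n, U i ω}) atTop (𝓝 0) := by
  have hintb : ∀ b, 0 ≤ b → b ≤ q → Integrable (fun ω => U 0 ω ^ b) P := by
    intro b hb0 hb
    refine Integrable.mono' (g := fun ω => 1 + U 0 ω ^ q) ((integrable_const _).add hint)
      ((hU 0).pow_const b).aestronglyMeasurable (ae_of_all _ fun ω => ?_)
    have hq0 : 0 ≤ U 0 ω ^ q := Real.rpow_nonneg (h0 0 ω) _
    rw [Real.norm_of_nonneg (Real.rpow_nonneg (h0 0 ω) _)]
    rcases le_total (U 0 ω) 1 with h | h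
    · linarith [Real.rpow_le_one (h0 0 ω) h hb0]
    · linarith [Real.rpow_le_rpow_of_exponent_le h hb]
  have hint1 : Integrable (U 0) P := by simpa using hintb 1 zero_le_one hq.le
  set m := ∫ ω, U 0 ω ∂P with hm
  set a := min q 2 with ha
  have ha1 : 1 < a := lt_min hq one_lt_two
  have ha2 : a ≤ 2 := min_le_right _ _
  set K := ∫ ω, U 0 ω ^ a ∂P with hK
  set d := t - m with hd
  have hd0 : 0 < d := sub_pos.mpr ht
  -- With `l = c * log n / n`, the drift `-l * n * (t - m)` equals `-q * log n`.
  set c := q / d with hc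
  have hc0 : 0 < c := by positivity
  -- With `M = n * s`, this makes `exp (2 * l * M) = n ^ (a - 1)`, so the remainder summed over `n`
  -- terms stays bounded.
  set s := (a - 1) / (2 * c) with hs
  have hs0 : 0 < s := div_pos (by linarith) (by positivity)
  have hbound : ∀ᶠ n : ℕ in atTop, (n : ℝ) ^ (q - 1) *
      P.real {ω | n * t ≤ ∑ i ∈ Finset.range n, U i ω} ≤
      (n : ℝ) ^ q * P.real {ω | n * s ≤ U 0 ω} +
        Real.exp (2 * (K / s ^ a)) * (n : ℝ)⁻¹ := by
    filter_upwards [eventually_gt_atTop 1] with n hn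
    have hn1 : (1 : ℝ) < n := by exact_mod_cast hn
    have hn0 : (0 : ℝ) < n := by linarith
    have hlog : 0 < Real.log n := Real.log_pos hn1
    have h := measureReal_sum_ge_le hU h0 hindep hident (a := a) (l := c * Real.log n / n)
      (M := n * s) (by linarith) ha2 (by positivity) (by positivity) hint1
      (hintb a (by linarith) (min_le_left _ _)) n t
    have e1 : 2 * (c * Real.log n / n * (n * s)) = Real.log n * (a - 1) := by
      rw [hs]; field_simp
    have e2 : K / ((n : ℝ) * s) ^ a * (n : ℝ) ^ (a - 1) = K / s ^ a * (n : ℝ)⁻¹ := by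
      rw [Real.mul_rpow hn0.le hs0.le, Real.rpow_sub_one hn0.ne']
      have : (n : ℝ) ^ a ≠ 0 := (Real.rpow_pos_of_pos hn0 _).ne'
      field_simp
    have e3 : -(c * Real.log n / n) * (n * t) + n * (c * Real.log n / n * m +
        2 * (K / ((n : ℝ) * s) ^ a * Real.exp (2 * (c * Real.log n / n * (n * s))))) =
        Real.log n * (-q) + 2 * (K / s ^ a) := by
      rw [e1, ← Real.rpow_def_of_pos hn0, e2]
      have : c * (t - m) = q := by rw [hc, ← hd]; field_simp
      field_simp
      linear_combination (-(s ^ a) * Real.log n) * this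
    rw [e3, Real.exp_add, ← Real.rpow_def_of_pos hn0] at h
    calc _ ≤ (n : ℝ) ^ (q - 1) * (n * P.real {ω | n * s ≤ U 0 ω} +
          (n : ℝ) ^ (-q) * Real.exp (2 * (K / s ^ a))) := by gcongr
      _ = _ := by
        have e4 : (n : ℝ) ^ (q - 1) * n = (n : ℝ) ^ q := by
          rw [Real.rpow_sub_one hn0.ne']; field_simp
        have e5 : (n : ℝ) ^ (q - 1) * (n : ℝ) ^ (-q) = (n : ℝ)⁻¹ := by
          rw [← Real.rpow_add hn0, ← Real.rpow_neg_one]; ring_nf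
        rw [mul_add, ← mul_assoc, ← mul_assoc, e4, e5, mul_comm (Real.exp _)]
  refine tendsto_of_tendsto_of_tendsto_of_le_of_le' tendsto_const_nhds ?_
    (Eventually.of_forall fun n => by positivity) hbound
  simpa using (tendsto_rpow_mul_measureReal_ge (hU 0) (h0 0) (by linarith) hs0 hint).add
    (tendsto_inv_atTop_nhds_zero_nat.const_mul (Real.exp (2 * (K / s ^ a))))

end UpperTail

/-! ### Stability of the tail rate under sums and scaling -/

section TailRate

variable {Ω : Type*} [MeasurableSpace Ω] {P : Measure Ω} [IsProbabilityMeasure P]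
  {F : Type*} [NormedAddCommGroup F]

/-- The tail probabilities `P(‖S n‖ ≥ δ)` are `o(n ^ (-r))` for every `δ > 0`. -/
def HasTailRate (P : Measure Ω) (r : ℝ) (S : ℕ → Ω → F) : Prop :=
  ∀ δ > 0, Tendsto (fun n : ℕ => (n : ℝ) ^ r * P.real {ω | δ ≤ ‖S n ω‖}) atTop (𝓝 0)

theorem HasTailRate.add {r : ℝ} {S T : ℕ → Ω → F} (hS : HasTailRate P r S)
    (hT : HasTailRate P r T) : HasTailRate P r (fun n ω => S n ω + T n ω) := by
  intro δ hδ
  have h := (hS (δ / 2) (by positivity)).add (hT (δ / 2) (by positivity))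
  rw [add_zero] at h
  refine squeeze_zero (fun n => by positivity) (fun n => ?_) h
  rw [← mul_add]
  gcongr
  refine (measureReal_mono fun ω hω => ?_).trans (measureReal_union_le _ _)
  simp only [Set.mem_union, Set.mem_ofPred_eq] at hω ⊢
  by_contra! hlt
  linarith [norm_add_le (S n ω) (T n ω)]

theorem HasTailRate.smul_const [NormedSpace ℝ F] {r : ℝ} {S : ℕ → Ω → ℝ}
    (hS : HasTailRate P r S) (c : F) : HasTailRate P r (fun n ω => S n ω • c) := by
  intro δ hδ
  -- Adding `1` covers the case `c = 0`.
  have hc : 0 < ‖c‖ + 1 := by positivity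
  refine squeeze_zero (fun n => by positivity) (fun n => ?_) (hS (δ / (‖c‖ + 1)) (by positivity))
  refine mul_le_mul_of_nonneg_left (measureReal_mono fun ω hω => ?_) (by positivity)
  simp only [Set.mem_ofPred_eq, norm_smul] at hω ⊢
  rw [div_le_iff₀ hc]
  refine hω.trans ?_
  gcongr
  linarith

end TailRate

/-! ### Empirical frequencies and simple functions -/

section EmpiricalMean

variable {Ω : Type*} [MeasurableSpace Ω] {P : Measure Ω} [IsProbabilityMeasure P]
  {E : Type*} [MeasurableSpace E] {X : ℕ → Ω → E}

theorem tendsto_rpow_mul_measureReal_sum_comp_ge (hmeas : ∀ i, Measurable (X i))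
    (hindep : iIndepFun X P) (hident : ∀ i, IdentDistrib (X i) (X 0) P P) {q : ℝ} (hq : 1 < q)
    {f : E → ℝ} (hf : Measurable f) (hf0 : ∀ x, 0 ≤ f x)
    (hint : Integrable (fun ω => f (X 0 ω) ^ q) P) {t : ℝ} (ht : ∫ ω, f (X 0 ω) ∂P < t) :
    Tendsto (fun n : ℕ => (n : ℝ) ^ (q - 1) *
      P.real {ω | n * t ≤ ∑ i ∈ Finset.range n, f (X i ω)}) atTop (𝓝 0) :=
  tendsto_rpow_mul_measureReal_sum_ge (fun i => hf.comp (hmeas i)) (fun _ _ => hf0 _)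
    (hindep.comp (fun _ => f) fun _ => hf) (fun i => (hident i).comp hf) hq hint ht

/-- Empirical frequencies converge to probabilities faster than any power of `n`. -/
theorem hasTailRate_frequency (hmeas : ∀ i, Measurable (X i))
    (hindep : iIndepFun X P) (hident : ∀ i, IdentDistrib (X i) (X 0) P P) {q : ℝ} (hq : 1 < q)
    {s : Set E} (hs : MeasurableSet s) :
    HasTailRate P (q - 1) (fun n ω => (n : ℝ)⁻¹ * ∑ i ∈ Finset.range n,
      s.indicator (1 : E → ℝ) (X i ω) - ∫ ω, s.indicator (1 : E → ℝ) (X 0 ω) ∂P) := by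
  have upper : ∀ u : Set E, MeasurableSet u → ∀ t, ∫ ω, u.indicator (1 : E → ℝ) (X 0 ω) ∂P < t →
      Tendsto (fun n : ℕ => (n : ℝ) ^ (q - 1) * P.real {ω | n * t ≤ ∑ i ∈ Finset.range n,
        u.indicator (1 : E → ℝ) (X i ω)}) atTop (𝓝 0) := by
    intro u hu t ht
    have hm : Measurable (u.indicator (1 : E → ℝ)) := measurable_one.indicator hu
    refine tendsto_rpow_mul_measureReal_sum_comp_ge hmeas hindep hident hq hm
      (Set.indicator_nonneg fun _ _ => zero_le_one) ?_ ht
    refine Integrable.of_bound (C := 1) ((hm.comp (hmeas 0)).pow_const q).aestronglyMeasurable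
      (ae_of_all _ fun ω => ?_)
    by_cases h : X 0 ω ∈ u
    · simp [h]
    · simp [h, Real.zero_rpow (by linarith : q ≠ 0)]
  have hint : ∀ u : Set E, MeasurableSet u →
      Integrable (fun ω => u.indicator (1 : E → ℝ) (X 0 ω)) P := by
    intro u hu
    refine Integrable.of_bound (C := 1)
      ((measurable_one.indicator hu).comp (hmeas 0)).aestronglyMeasurable
      (ae_of_all _ fun ω => ?_)
    by_cases h : X 0 ω ∈ u <;> simp [h]
  have hcompl : ∀ x, sᶜ.indicator (1 : E → ℝ) x = 1 - s.indicator (1 : E → ℝ) x := by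
    intro x
    by_cases h : x ∈ s <;> simp [h]
  set m := ∫ ω, s.indicator (1 : E → ℝ) (X 0 ω) ∂P with hm
  have hmc : ∫ ω, sᶜ.indicator (1 : E → ℝ) (X 0 ω) ∂P = 1 - m := by
    simp_rw [hcompl]
    rw [integral_sub (integrable_const _) (hint s hs)]
    simp [hm]
  intro δ hδ
  -- A lower deviation for `s` is an upper deviation for `sᶜ`, so the one-sided bound suffices.
  have h := (upper s hs (m + δ) (by linarith)).add
    (upper sᶜ hs.compl (1 - m + δ) (by rw [hmc]; linarith))
  rw [add_zero] at h
  refine squeeze_zero' (Eventually.of_forall fun n => by positivity) ?_ h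
  filter_upwards [eventually_gt_atTop 0] with n hn
  have hn0 : (0 : ℝ) < n := by exact_mod_cast hn
  rw [← mul_add]
  gcongr
  refine (measureReal_mono fun ω hω => ?_).trans (measureReal_union_le _ _)
  simp only [Set.mem_union, Set.mem_ofPred_eq, hcompl, Real.norm_eq_abs, Finset.sum_sub_distrib,
    Finset.sum_const, Finset.card_range, nsmul_eq_mul, mul_one, le_abs] at hω ⊢
  set Z := ∑ i ∈ Finset.range n, s.indicator (1 : E → ℝ) (X i ω)
  have hZ : Z = n * ((n : ℝ)⁻¹ * Z) := by field_simp
  rcases hω with hω | hω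
  · left
    rw [hZ]
    gcongr
    linarith
  · right
    rw [hZ, show (n : ℝ) - n * ((n : ℝ)⁻¹ * Z) = n * (1 - (n : ℝ)⁻¹ * Z) by ring]
    gcongr
    linarith

variable {F : Type*} [NormedAddCommGroup F]

theorem integrable_simpleFunc_comp (hmeas : ∀ i, Measurable (X i)) (g : SimpleFunc E F) :
    Integrable (fun ω => g (X 0 ω)) P := by
  have := (SimpleFunc.integrable_of_isFiniteMeasure (μ := P) (g.comp (X 0) (hmeas 0)))
  exact this

theorem hasTailRate_simpleFunc [NormedSpace ℝ F] [CompleteSpace F] (hmeas : ∀ i, Measurable (X i))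
    (hindep : iIndepFun X P) (hident : ∀ i, IdentDistrib (X i) (X 0) P P) {q : ℝ} (hq : 1 < q)
    (g : SimpleFunc E F) :
    HasTailRate P (q - 1) (fun n ω => (n : ℝ)⁻¹ • ∑ i ∈ Finset.range n, g (X i ω) -
      ∫ ω, g (X 0 ω) ∂P) := by
  induction g using SimpleFunc.induction with
  | @const c s hs =>
    have h := (hasTailRate_frequency hmeas hindep hident hq hs).smul_const c
    have he : ∀ x, (SimpleFunc.piecewise s hs (SimpleFunc.const E c) (SimpleFunc.const E 0)) x =
        s.indicator (1 : E → ℝ) x • c := by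
      intro x
      by_cases hx : x ∈ s <;> simp [hx]
    simp_rw [he]
    simpa only [integral_smul_const, sub_smul, Finset.sum_smul, Finset.smul_sum, mul_smul,
      Finset.mul_sum] using h
  | @add f g _ hf hg =>
    have h := hf.add hg
    simp only [SimpleFunc.coe_add, Pi.add_apply]
    rw [integral_add (integrable_simpleFunc_comp hmeas f) (integrable_simpleFunc_comp hmeas g)]
    convert h using 3
    rw [Finset.sum_add_distrib, smul_add]
    abel

end EmpiricalMean

/-! ### Weak law with rate in a Banach space -/

section WeakLaw

variable {Ω : Type*} [MeasurableSpace Ω] {P : Measure Ω} [IsProbabilityMeasure P]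
  {E : Type*} [NormedAddCommGroup E] [NormedSpace ℝ E] [CompleteSpace E]
  [SecondCountableTopology E] [MeasurableSpace E] [BorelSpace E] {X : ℕ → Ω → E}

omit [NormedSpace ℝ E] [CompleteSpace E] in
theorem integrable_of_integrable_norm_rpow {Y : Ω → E} (hY : Measurable Y) {q : ℝ} (hq : 1 ≤ q)
    (hmom : Integrable (fun ω => ‖Y ω‖ ^ q) P) : Integrable Y P := by
  refine Integrable.mono' (g := fun ω => 1 + ‖Y ω‖ ^ q) ((integrable_const _).add hmom)
    hY.aestronglyMeasurable (ae_of_all _ fun ω => ?_)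
  have hq0 : 0 ≤ ‖Y ω‖ ^ q := by positivity
  rcases le_total ‖Y ω‖ 1 with h | h
  · linarith
  · have := Real.rpow_le_rpow_of_exponent_le h hq
    rw [Real.rpow_one] at this
    linarith

/-- **Rate in the weak law of large numbers**: for i.i.d. random variables with finite moment of
order `q > 1` in a separable Banach space, `P(‖S_n / n - E X‖ ≥ δ) = o(n ^ (1 - q))`. -/
theorem hasTailRate_mean (hmeas : ∀ i, Measurable (X i))
    (hindep : iIndepFun X P) (hident : ∀ i, IdentDistrib (X i) (X 0) P P) {q : ℝ} (hq : 1 < q)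
    (hmom : Integrable (fun ω => ‖X 0 ω‖ ^ q) P) :
    HasTailRate P (q - 1) (fun n ω => (n : ℝ)⁻¹ • ∑ i ∈ Finset.range n, X i ω -
      ∫ ω, X 0 ω ∂P) := by
  intro δ hδ
  have hint : Integrable (X 0) P := integrable_of_integrable_norm_rpow (hmeas 0) hq.le hmom
  have hid : MemLp (id : E → E) 1 (P.map (X 0)) := by
    rw [memLp_map_measure_iff aestronglyMeasurable_id (hmeas 0).aemeasurable]
    exact memLp_one_iff_integrable.mpr hint
  obtain ⟨g, hg, -⟩ := hid.exists_simpleFunc_eLpNorm_sub_lt ENNReal.one_ne_top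
    (ε := ENNReal.ofReal (δ / 4)) (by simpa using hδ)
  have hgi : Integrable (fun ω => g (X 0 ω)) P := integrable_simpleFunc_comp hmeas g
  have hdm : Measurable fun x => ‖x - g x‖ := (measurable_id.sub g.measurable).norm
  have hmean : ∫ ω, ‖X 0 ω - g (X 0 ω)‖ ∂P < δ / 4 := by
    rw [eLpNorm_map_measure (aestronglyMeasurable_id.sub g.aestronglyMeasurable)
      (hmeas 0).aemeasurable, eLpNorm_one_eq_lintegral_enorm] at hg
    have he := integral_norm_eq_lintegral_enorm (hint.sub hgi).aestronglyMeasurable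
    simp only [Pi.sub_apply] at he
    rw [he]
    exact (ENNReal.lt_ofReal_iff_toReal_lt hg.ne_top).mp hg
  have hmomd : Integrable (fun ω => ‖X 0 ω - g (X 0 ω)‖ ^ q) P := by
    have hXq : MemLp (X 0) (ENNReal.ofReal q) P := by
      rw [← integrable_norm_rpow_iff (hmeas 0).aestronglyMeasurable (by simp; linarith)
        ENNReal.ofReal_ne_top, ENNReal.toReal_ofReal (by linarith)]
      exact hmom
    have hgq : MemLp (fun ω => g (X 0 ω)) (ENNReal.ofReal q) P :=
      SimpleFunc.memLp_of_finite_measure_preimage (μ := P) (ENNReal.ofReal q)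
        (f := g.comp (X 0) (hmeas 0)) fun _ _ => measure_lt_top _ _
    have := (hXq.sub hgq).integrable_norm_rpow'
    rwa [ENNReal.toReal_ofReal (by linarith)] at this
  -- The budget `δ` splits as `δ / 2` for the simple part, `δ / 4` for the empirical mean of the
  -- error and `δ / 4` for its expectation.
  have h := (hasTailRate_simpleFunc hmeas hindep hident hq g (δ / 2) (by positivity)).add
    (tendsto_rpow_mul_measureReal_sum_comp_ge hmeas hindep hident hq hdm
      (fun _ => norm_nonneg _) hmomd hmean)
  rw [add_zero] at h
  refine squeeze_zero' (Eventually.of_forall fun n => by positivity) ?_ h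
  filter_upwards [eventually_gt_atTop 0] with n hn
  have hn0 : (0 : ℝ) < n := by exact_mod_cast hn
  rw [← mul_add]
  gcongr
  refine (measureReal_mono fun ω hω => ?_).trans (measureReal_union_le _ _)
  simp only [Set.mem_union, Set.mem_ofPred_eq] at hω ⊢
  by_contra! hlt
  obtain ⟨h1, h2⟩ := hlt
  have h3 : ‖(n : ℝ)⁻¹ • ∑ i ∈ Finset.range n, (X i ω - g (X i ω))‖ < δ / 4 := by
    rw [norm_smul, norm_inv, RCLike.norm_natCast, inv_mul_lt_iff₀ hn0]
    exact (norm_sum_le _ _).trans_lt h2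
  have h4 : ‖∫ ω, (X 0 ω - g (X 0 ω)) ∂P‖ < δ / 4 :=
    (norm_integral_le_integral_norm _).trans_lt hmean
  have h5 : (n : ℝ)⁻¹ • ∑ i ∈ Finset.range n, X i ω - ∫ ω, X 0 ω ∂P =
      ((n : ℝ)⁻¹ • ∑ i ∈ Finset.range n, g (X i ω) - ∫ ω, g (X 0 ω) ∂P) +
      ((n : ℝ)⁻¹ • ∑ i ∈ Finset.range n, (X i ω - g (X i ω)) -
        ∫ ω, (X 0 ω - g (X 0 ω)) ∂P) := by
    rw [integral_sub hint hgi, Finset.sum_sub_distrib, smul_sub]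
    abel
  rw [h5] at hω
  have h6 := norm_add_le ((n : ℝ)⁻¹ • ∑ i ∈ Finset.range n, g (X i ω) - ∫ ω, g (X 0 ω) ∂P)
    ((n : ℝ)⁻¹ • ∑ i ∈ Finset.range n, (X i ω - g (X i ω)) - ∫ ω, (X 0 ω - g (X 0 ω)) ∂P)
  have h7 := norm_sub_le ((n : ℝ)⁻¹ • ∑ i ∈ Finset.range n, (X i ω - g (X i ω)))
    (∫ ω, (X 0 ω - g (X 0 ω)) ∂P)
  linarith

end WeakLaw

/-! ### Comparison at the mean, and conclusion -/

theorem apply_integral_le_shortfallCumulant {Ω E : Type*} [MeasurableSpace Ω]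
    [NormedAddCommGroup E] [NormedSpace ℝ E] [CompleteSpace E] {P : Measure Ω}
    [IsProbabilityMeasure P] {q : ℝ} (hq : 1 < q) {Y : Ω → E} (hY : Integrable Y P)
    (x' : StrongDual ℝ E) :
    ((x' (∫ ω, Y ω ∂P) : ℝ) : EReal) ≤ shortfallCumulant P q Y x' := by
  refine le_sInf ?_
  rintro _ ⟨m, hm, rfl⟩
  rw [Set.mem_ofPred_eq] at hm
  rw [EReal.coe_le_coe_iff]
  have hx : Integrable (fun ω => x' (Y ω)) P := x'.integrable_comp hY
  have hlin : Integrable (fun ω => 1 + q * (x' (Y ω) - m)) P :=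
    (integrable_const _).add ((hx.sub (integrable_const _)).const_mul q)
  have hnn : ∀ ω, 0 ≤ (max (1 + x' (Y ω) - m) 0) ^ q := fun ω =>
    Real.rpow_nonneg (le_max_right _ _) _
  have hW : AEStronglyMeasurable (fun ω => (max (1 + x' (Y ω) - m) 0) ^ q) P := by
    exact ((((hx.aemeasurable.const_add 1).sub_const m).max aemeasurable_const).pow_const
      q).aestronglyMeasurable
  have hWi : Integrable (fun ω => (max (1 + x' (Y ω) - m) 0) ^ q) P := by
    refine ⟨hW, ?_⟩
    rw [hasFiniteIntegral_iff_ofReal (ae_of_all _ hnn)]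
    exact hm.trans_lt ENNReal.one_lt_top
  have h1 : ∫ ω, (max (1 + x' (Y ω) - m) 0) ^ q ∂P ≤ 1 := by
    rw [integral_eq_lintegral_of_nonneg_ae (ae_of_all _ hnn) hW]
    exact ENNReal.toReal_le_of_le_ofReal zero_le_one (by simpa using hm)
  have h2 : ∫ ω, (1 + q * (x' (Y ω) - m)) ∂P ≤ ∫ ω, (max (1 + x' (Y ω) - m) 0) ^ q ∂P := by
    refine integral_mono hlin hWi fun ω => ?_
    have hmax := le_max_left (1 + x' (Y ω) - m) 0
    have hmax0 := le_max_right (1 + x' (Y ω) - m) 0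
    -- Bernoulli linearizes the power at `1`; after integration, admissibility of `m` reads `1 + q *
    -- (x' (E Y) - m) ≤ 1`.
    have hb := one_add_mul_self_le_rpow_one_add
      (s := max (1 + x' (Y ω) - m) 0 - 1) (by linarith) hq.le
    rw [add_sub_cancel] at hb
    refine le_trans ?_ hb
    have : x' (Y ω) - m ≤ max (1 + x' (Y ω) - m) 0 - 1 := by linarith
    dsimp only
    gcongr
  rw [integral_add (g := fun ω => q * (x' (Y ω) - m)) (integrable_const _)
    ((hx.sub (integrable_const _)).const_mul q), integral_const_mul, integral_sub hx (integrable_const _), x'.integral_comp_comm hY] at h2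
  simp only [integral_const, probReal_univ, one_smul] at h2
  nlinarith

theorem convexConjugate_shortfallCumulant_integral_le {Ω E : Type*} [MeasurableSpace Ω]
    [NormedAddCommGroup E] [NormedSpace ℝ E] [CompleteSpace E] {P : Measure Ω}
    [IsProbabilityMeasure P] {q : ℝ} (hq : 1 < q) {Y : Ω → E} (hY : Integrable Y P) :
    convexConjugate (shortfallCumulant P q Y) (∫ ω, Y ω ∂P) ≤ 0 := by
  refine iSup_le fun x' => ?_
  exact EReal.sub_nonpos.mpr (apply_integral_le_shortfallCumulant hq hY x')

theorem corollary1p3 {Ω : Type*} [MeasurableSpace Ω] (P : Measure Ω) [IsProbabilityMeasure P]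
    {E : Type*} [NormedAddCommGroup E] [NormedSpace ℝ E] [CompleteSpace E]
    [TopologicalSpace.SeparableSpace E] [MeasurableSpace E] [BorelSpace E]
    (p q : ℝ) (hp : 1 < p) (hq : q = p / (p - 1))
    (X : ℕ → Ω → E) (hmeas : ∀ i, Measurable (X i))
    (hindep : iIndepFun X P) (hident : ∀ i, IdentDistrib (X i) (X 0) P P)
    (hmom : Integrable (fun ω => ‖X 0 ω‖ ^ q) P)
    (A : Set E) (hA : IsClosed A) :
    limsup (fun n : ℕ => (n : ℝ≥0∞) ^ (1 / p) *
        (P {ω | (n : ℝ)⁻¹ • ∑ i ∈ Finset.range n, X i ω ∈ A}) ^ (1 / q)) atTop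
      ≤ ((⨅ x ∈ A, convexConjugate (shortfallCumulant P q (X 0)) x).toENNReal)⁻¹ := by
  have : SecondCountableTopology E := UniformSpace.secondCountable_of_separable E
  have hp1 : 0 < p - 1 := by linarith
  have hq1 : 1 < q := by rw [hq, one_lt_div hp1]; linarith
  have hq0 : 0 < q := by linarith
  have hpq : (q - 1) * (1 / q) = 1 / p := by rw [hq]; field_simp; ring
  have hint : Integrable (X 0) P := integrable_of_integrable_norm_rpow (hmeas 0) hq1.le hmom
  by_cases hmA : ∫ ω, X 0 ω ∂P ∈ A
  · have h0 : (⨅ x ∈ A, convexConjugate (shortfallCumulant P q (X 0)) x) ≤ 0 :=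
      (iInf₂_le _ hmA).trans (convexConjugate_shortfallCumulant_integral_le hq1 hint)
    rw [EReal.toENNReal_of_nonpos h0, ENNReal.inv_zero]
    exact le_top
  obtain ⟨δ, hδ, hball⟩ := Metric.isOpen_iff.mp hA.isOpen_compl _ hmA
  have hrate : Tendsto (fun n : ℕ => (n : ℝ) ^ (q - 1) *
      P.real {ω | (n : ℝ)⁻¹ • ∑ i ∈ Finset.range n, X i ω ∈ A}) atTop (𝓝 0) := by
    refine squeeze_zero (fun n => by positivity) (fun n => ?_)
      (hasTailRate_mean hmeas hindep hident hq1 hmom δ hδ)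
    refine mul_le_mul_of_nonneg_left (measureReal_mono fun ω hω => ?_) (by positivity)
    rw [Set.mem_ofPred_eq] at hω ⊢
    by_contra! hlt
    exact hball (by rwa [Metric.mem_ball, dist_eq_norm]) hω
  have hlim : Tendsto (fun n : ℕ => (n : ℝ≥0∞) ^ (1 / p) *
      (P {ω | (n : ℝ)⁻¹ • ∑ i ∈ Finset.range n, X i ω ∈ A}) ^ (1 / q)) atTop (𝓝 0) := by
    -- Taking `q`-th roots turns the factor `n ^ (q - 1)` into `n ^ (1 / p)`.
    have h := (ENNReal.tendsto_ofReal hrate).ennrpow_const (1 / q)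
    rw [ENNReal.ofReal_zero, ENNReal.zero_rpow_of_pos (by positivity)] at h
    refine h.congr fun n => ?_
    rw [ENNReal.ofReal_mul (by positivity), ENNReal.mul_rpow_of_nonneg _ _ (by positivity),
      ofReal_measureReal, ← ENNReal.ofReal_rpow_of_nonneg (by positivity) (by linarith),
      ENNReal.ofReal_natCast, ← ENNReal.rpow_mul, hpq]
  rw [hlim.limsup_eq]
  exact zero_le
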